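/- Let $k\ge 1$, let $\Theta_k=\{\theta\in\mathbb R^k:\theta_i>0\ (1\le i\le k),\ \theta_1+\dots+\theta_k<1\}$, and for $\theta\in\Theta_k$ put $\theta_{k+1}=1-\theta_1-\dots-\theta_k$. Let $\Pi$ be a probability measure on $\Theta_k$ with density $\pi\ge 0$ with respect to $k$-dimensional volume, and let $\Theta_{k,c}$ and $\Theta_{k,d}$ be the sets of points of $\Theta_k$ at which $\pi:\Theta_k\to[0,\infty)$ is continuous, respectively discontinuous. Assume: (A1) there is $B>0$ with $\pi(\theta)\le B$ for all $\theta\in\Theta_k$; (A2) $\mathrm{vol}(\Theta_{k,d})=0$; (A3) $\Pi(\{\theta\in\Theta_k:\pi(\theta)=l\})=0$ for every $l\ge 0$. For $n\ge 0$ let $D_{k,n}=\{t\in\mathbb N_0^k:t_1+\dots+t_k\le n\}$, put $t_{k+1}=n-t_1-\dots-t_k$ for $t\in D_{k,n}$, and let $M_{T_n}$ be the prior predictive distribution on $D_{k,n}$, which has probability function $$m_{T_n}(t)=\frac{n!}{\prod_{j=1}^{k+1}t_j!}\int_{\Theta_k}\prod_{j=1}^{k+1}\theta_j^{t_j}\,\pi(\theta)\,d\theta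 .$$ Let $\theta^{\mathrm{true}}\in\Theta_{k,c}$, let $x=(x_1,x_2,\dots)$ be an i.i.d. sequence with values in $\{1,\dots,k+1\}$ such that $x_i=j$ with probability $\theta^{\mathrm{true}}_j$, and let $T_n(x)\in D_{k,n}$ be the vector of the numbers of indices $i\le n$ with $x_i=1,\dots,x_i=k$. Then, almost surely, $$M_{T_n}\big(\{t\in D_{k,n}:m_{T_n}(t)\le m_{T_n}(T_n(x))\}\big)\ \longrightarrow\ \Pi\big(\{\theta\in\Theta_k:\pi(\theta)\le\pi(\theta^{\mathrm{true}})\}\big)\qquad(n\to\infty).$$ -/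

import Mathlib

open MeasureTheory ProbabilityTheory Filter Topology

noncomputable section

namespace MultinomialPrior

/-- The open simplex `Θ_k` in `ℝ^k`: the possible values of the first `k` of the `k + 1` cell
probabilities. -/
def openSimplex (k : ℕ) : Set (Fin k → ℝ) :=
  {θ | (∀ i, 0 < θ i) ∧ ∑ i, θ i < 1}

/-- All `k + 1` cell probabilities `(θ₁, …, θ_k, 1 - θ₁ - ⋯ - θ_k)`. -/
def cellProb {k : ℕ} (θ : Fin k → ℝ) : Fin (k + 1) → ℝ :=
  Fin.snoc (α := fun _ => ℝ) θ (1 - ∑ i, θ i)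

/-- The possible values `D_{k,n}` of the counts in the first `k` cells for sample size `n`. -/
def countSet (k n : ℕ) : Finset (Fin k → ℕ) :=
  (Fintype.piFinset fun _ => Finset.range (n + 1)).filter fun t => ∑ i, t i ≤ n

/-- All `k + 1` cell counts `(t₁, …, t_k, n - t₁ - ⋯ - t_k)`, for `t` in `countSet k n`. -/
def cellCount {k : ℕ} (n : ℕ) (t : Fin k → ℕ) : Fin (k + 1) → ℕ :=
  Fin.snoc (α := fun _ => ℕ) t (n - ∑ i, t i)

/-- The statistic `T_n`: the numbers of observations among the first `n` that fall in each of the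
first `k` cells. -/
def counts {k : ℕ} (n : ℕ) (x : ℕ → Fin (k + 1)) : Fin k → ℕ :=
  fun i => ((Finset.range n).filter fun j => x j = i.castSucc).card

/-- The prior `Π` on `Θ_k` with density `π` with respect to volume. -/
def prior {k : ℕ} (π : (Fin k → ℝ) → ℝ) : Measure (Fin k → ℝ) :=
  (volume.restrict (openSimplex k)).withDensity fun θ => ENNReal.ofReal (π θ)

/-- `π` is a probability density on `Θ_k`; its values off `Θ_k` play no role. -/
structure IsPriorDensity {k : ℕ} (π : (Fin k → ℝ) → ℝ) : Prop where
  aemeasurable : AEMeasurable π (volume.restrict (openSimplex k))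
  nonneg : ∀ θ ∈ openSimplex k, 0 ≤ π θ
  isProbabilityMeasure : IsProbabilityMeasure (prior π)

/-- The set `Θ_{k,c}` of continuity points of the density on `Θ_k`. -/
def contPts {k : ℕ} (π : (Fin k → ℝ) → ℝ) : Set (Fin k → ℝ) :=
  {θ | θ ∈ openSimplex k ∧ ContinuousWithinAt π (openSimplex k) θ}

/-- The set `Θ_{k,d}` of discontinuity points of the density on `Θ_k`. -/
def discontPts {k : ℕ} (π : (Fin k → ℝ) → ℝ) : Set (Fin k → ℝ) :=
  {θ | θ ∈ openSimplex k ∧ ¬ ContinuousWithinAt π (openSimplex k) θ}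

/-- The prior predictive probability function `m_{T_n}` (meant for `t` in `countSet k n`). -/
def predictive {k : ℕ} (π : (Fin k → ℝ) → ℝ) (n : ℕ) (t : Fin k → ℕ) : ℝ :=
  (n.factorial : ℝ) / (∏ j, ((cellCount n t j).factorial : ℝ)) *
    ∫ θ in openSimplex k, (∏ j, cellProb θ j ^ cellCount n t j) * π θ

/-- The prior predictive distribution `M_{T_n}` of `T_n`, carried by `countSet k n`. -/
def predictiveMeasure {k : ℕ} (π : (Fin k → ℝ) → ℝ) (n : ℕ) : Measure (Fin k → ℕ) :=
  ∑ t ∈ countSet k n, ENNReal.ofReal (predictive π n t) • Measure.dirac t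

/-- The prior-data conflict p-value `M_{T_n}(m_{T_n}(t) ≤ m_{T_n}(tobs))` of an observed value
`tobs` of `T_n`. -/
def pValue {k : ℕ} (π : (Fin k → ℝ) → ℝ) (n : ℕ) (tobs : Fin k → ℕ) : ℝ :=
  (predictiveMeasure π n).real {t | predictive π n t ≤ predictive π n tobs}

/-- `X₀, X₁, …` are i.i.d. multinomial`(1, θ₁, …, θ_{k+1})`: independent random cells, with cell
`j` having probability `θ_j`. -/
structure IsIIDSample {k : ℕ} {Ω : Type*} [MeasurableSpace Ω] (P : Measure Ω)
    (X : ℕ → Ω → Fin (k + 1)) (θ : Fin k → ℝ) : Prop where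
  measurable : ∀ i, Measurable (X i)
  indep : iIndepFun X P
  law : ∀ i j, P (X i ⁻¹' {j}) = ENNReal.ofReal (cellProb θ j)

end MultinomialPrior

end

/-! Up to the factor `(n + k)! / n!`, which does not depend on `t`, the predictive mass of `t` is
the mean of `π` under the Dirichlet posterior that the uniform prior yields given `t`
(`uniformPosteriorMean_eq_mul_predictive`). Ranking counts by predictive mass is thus ranking them
by this posterior mean. The posterior concentrates near `t / n`, so the mean tends to `π θ₀` when `t
/ n` tends to a continuity point `θ₀` (`tendsto_uniformPosteriorMean`).

Swapping sum and integral makes the p-value the `Π`-average over `θ` of the multinomial(`θ`)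
probability that the posterior mean given `t` is at most the one given the observed counts
(`pValue_eq_integral`). The observed mean tends to `π θtrue` almost surely, by the strong law. For
almost every `θ`, the mean under multinomial(`θ`) concentrates at `π θ`, by the weak law and (A2).
The inner probability therefore tends to the indicator of `π θ ≤ π θtrue`, except on the level set
`π θ = π θtrue`, which is `Π`-null by (A3). Dominated convergence concludes. -/

namespace MultinomialPrior

/-! ### Beta and Dirichlet integrals -/

/-- Integration by parts trades a power of `x` for a power of `a - x`; hence the induction on `m`
with `n` free. -/
theorem integral_pow_mul_sub_pow (a : ℝ) (m n : ℕ) :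
    ∫ x in (0 : ℝ)..a, x ^ m * (a - x) ^ n =
      a ^ (m + n + 1) * ((m.factorial * n.factorial : ℝ) / (m + n + 1).factorial) := by
  induction m generalizing n with
  | zero =>
    have h : ∫ x in (0 : ℝ)..a, (a - x) ^ n = ∫ x in (0 : ℝ)..a, x ^ n := by
      rw [intervalIntegral.integral_comp_sub_left (fun x => x ^ n) a]; simp
    simp only [pow_zero, one_mul, h, integral_pow, Nat.factorial_zero, Nat.cast_one, zero_add,
      Nat.factorial_succ]
    have : (n.factorial : ℝ) ≠ 0 := by positivity
    push_cast
    field_simp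
    simp
  | succ m ih =>
    have hd : ∀ x ∈ Set.uIcc 0 a, HasDerivAt (fun x : ℝ => x ^ (m + 1) * (a - x) ^ (n + 1))
        ((m + 1) * (x ^ m * (a - x) ^ (n + 1)) - (n + 1) * (x ^ (m + 1) * (a - x) ^ n)) x := by
      intro x _
      have h1 := hasDerivAt_pow (m + 1) x
      have h2 := ((hasDerivAt_id x).const_sub a).fun_pow (n + 1)
      refine (h1.fun_mul h2).congr_deriv ?_
      simp only [Nat.add_sub_cancel, id]
      push_cast
      ring
    have hI := intervalIntegral.integral_eq_sub_of_hasDerivAt hd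
      (Continuous.intervalIntegrable (by fun_prop) _ _)
    rw [intervalIntegral.integral_sub (Continuous.intervalIntegrable (by fun_prop) _ _)
      (Continuous.intervalIntegrable (by fun_prop) _ _), intervalIntegral.integral_const_mul,
      intervalIntegral.integral_const_mul, ih (n + 1)] at hI
    have hn : (n + 1 : ℝ) ≠ 0 := by positivity
    have : m + (n + 1) + 1 = m + 1 + n + 1 := by ring
    rw [this] at hI
    -- The boundary terms vanish at both ends.
    have hz : a ^ (m + 1) * (a - a) ^ (n + 1) - 0 ^ (m + 1) * (a - 0) ^ (n + 1) = 0 := by simp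
    rw [hz, sub_eq_zero] at hI
    apply mul_left_cancel₀ hn
    rw [← hI, Nat.factorial_succ m, Nat.factorial_succ n]
    push_cast
    ring

/-- The `lintegral` form lets Tonelli apply in the Dirichlet induction without integrability checks.
-/
theorem lintegral_pow_mul_sub_pow {a : ℝ} (ha : 0 < a) (m n : ℕ) :
    ∫⁻ x in Set.Ioo 0 a, ENNReal.ofReal (x ^ m * (a - x) ^ n) =
      ENNReal.ofReal
        (a ^ (m + n + 1) * ((m.factorial * n.factorial : ℝ) / (m + n + 1).factorial)) := by
  rw [← integral_pow_mul_sub_pow, intervalIntegral.integral_of_le ha.le,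
    ← integral_Ioc_eq_integral_Ioo.symm, ← ofReal_integral_eq_lintegral_ofReal]
  · exact ((Continuous.integrableOn_Icc (by fun_prop)).mono_set Set.Ioo_subset_Icc_self)
  · filter_upwards [ae_restrict_mem measurableSet_Ioo] with x hx
    have := sub_pos.2 hx.2
    have := hx.1
    positivity

/-- The open simplex of side length `a`. -/
def scaledSimplex (k : ℕ) (a : ℝ) : Set (Fin k → ℝ) :=
  {θ | (∀ i, 0 < θ i) ∧ ∑ i, θ i < a}

theorem measurableSet_scaledSimplex (k : ℕ) (a : ℝ) : MeasurableSet (scaledSimplex k a) := by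
  unfold scaledSimplex
  measurability

theorem cons_mem_scaledSimplex {k : ℕ} {a x : ℝ} {y : Fin k → ℝ} :
    (Fin.cons x y : Fin (k + 1) → ℝ) ∈ scaledSimplex (k + 1) a ↔
      x ∈ Set.Ioo 0 a ∧ y ∈ scaledSimplex k (a - x) := by
  simp only [scaledSimplex, Set.mem_ofPred_eq, Fin.forall_fin_succ, Fin.cons_zero, Fin.cons_succ,
    Fin.sum_univ_succ, Set.mem_Ioo]
  constructor
  · rintro ⟨⟨h1, h2⟩, h3⟩
    have : 0 ≤ ∑ i, y i := Finset.sum_nonneg fun i _ => (h2 i).le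
    exact ⟨⟨h1, by linarith⟩, h2, by linarith⟩
  · rintro ⟨⟨h1, h2⟩, h3, h4⟩
    exact ⟨⟨h1, h3⟩, by linarith⟩

/-- The Dirichlet integral over the simplex of side length `a`. -/
theorem lintegral_scaledSimplex {k : ℕ} (t : Fin k → ℕ) (s : ℕ) {a : ℝ} (ha : 0 < a) :
    ∫⁻ θ in scaledSimplex k a, ENNReal.ofReal ((∏ i, θ i ^ t i) * (a - ∑ i, θ i) ^ s) =
      ENNReal.ofReal (a ^ (∑ i, t i + s + k) *
        ((∏ i, ((t i).factorial : ℝ)) * s.factorial / (∑ i, t i + s + k).factorial)) := by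
  induction k generalizing a with
  | zero =>
    have h : scaledSimplex 0 a = Set.univ := by
      ext θ; simp [scaledSimplex, ha]
    have : (s.factorial : ℝ) ≠ 0 := by positivity
    simp [h, volume_pi, this]
  | succ k ih =>
    have hmp := (volume_preserving_piFinSuccAbove (fun _ : Fin (k + 1) => ℝ) 0).symm
    rw [← lintegral_indicator (measurableSet_scaledSimplex _ _), ← hmp.lintegral_comp_emb
      (MeasurableEquiv.measurableEmbedding _), Measure.volume_eq_prod, lintegral_prod]
    swap
    · have hm : Measurable ((scaledSimplex (k + 1) a).indicator
          (fun θ => ENNReal.ofReal ((∏ i, θ i ^ t i) * (a - ∑ i, θ i) ^ s))) :=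
        Measurable.indicator (by fun_prop) (measurableSet_scaledSimplex _ _)
      exact (hm.comp
        (MeasurableEquiv.piFinSuccAbove (fun _ : Fin (k + 1) => ℝ) 0).symm.measurable).aemeasurable
    -- With the first coordinate `x` fixed, the induction hypothesis on the slice of side `a - x`
    -- gives `C * (a - x) ^ N`; a Beta integral in `x` remains.
    set N := ∑ i, t (Fin.succ i) + s + k with hN
    set C : ℝ := (∏ i, ((t (Fin.succ i)).factorial : ℝ)) * s.factorial / N.factorial with hC
    have hC0 : 0 ≤ C := by positivity
    have key : ∀ x : ℝ, ∫⁻ y : Fin k → ℝ, (scaledSimplex (k + 1) a).indicator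
        (fun θ => ENNReal.ofReal ((∏ i, θ i ^ t i) * (a - ∑ i, θ i) ^ s))
        ((MeasurableEquiv.piFinSuccAbove (fun _ : Fin (k + 1) => ℝ) 0).symm (x, y)) =
        (Set.Ioo 0 a).indicator (fun x => ENNReal.ofReal C *
          ENNReal.ofReal (x ^ t 0 * (a - x) ^ N)) x := by
      intro x
      have e : ∀ y : Fin k → ℝ,
          (MeasurableEquiv.piFinSuccAbove (fun _ : Fin (k + 1) => ℝ) 0).symm (x, y) =
            Fin.cons x y := by
        intro y
        simp [MeasurableEquiv.piFinSuccAbove, Fin.insertNthEquiv]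
      simp only [e]
      by_cases hx : x ∈ Set.Ioo 0 a
      · rw [Set.indicator_of_mem hx, ← ENNReal.ofReal_mul hC0]
        have : ∀ y : Fin k → ℝ, (scaledSimplex (k + 1) a).indicator
            (fun θ => ENNReal.ofReal ((∏ i, θ i ^ t i) * (a - ∑ i, θ i) ^ s)) (Fin.cons x y) =
            ENNReal.ofReal (x ^ t 0) * (scaledSimplex k (a - x)).indicator (fun y =>
              ENNReal.ofReal ((∏ i, y i ^ t (Fin.succ i)) * (a - x - ∑ i, y i) ^ s)) y := by
          intro y
          by_cases hy : y ∈ scaledSimplex k (a - x)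
          · rw [Set.indicator_of_mem hy, Set.indicator_of_mem (cons_mem_scaledSimplex.2 ⟨hx, hy⟩),
              ← ENNReal.ofReal_mul (pow_nonneg hx.1.le _)]
            simp only [Fin.prod_univ_succ, Fin.sum_univ_succ, Fin.cons_zero, Fin.cons_succ]
            congr 1
            rw [← sub_sub, mul_assoc]
          · rw [Set.indicator_of_notMem hy, Set.indicator_of_notMem
              (fun h => hy (cons_mem_scaledSimplex.1 h).2), mul_zero]
        simp_rw [this]
        rw [lintegral_const_mul' _ _ ENNReal.ofReal_ne_top,
          lintegral_indicator (measurableSet_scaledSimplex _ _), ih _ (sub_pos.2 hx.2),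
          ← ENNReal.ofReal_mul (pow_nonneg hx.1.le _)]
        congr 1
        ring
      · rw [Set.indicator_of_notMem hx]
        simp_rw [Set.indicator_of_notMem (fun h => hx (cons_mem_scaledSimplex.1 h).1)]
        simp
    simp_rw [key]
    rw [lintegral_indicator measurableSet_Ioo, lintegral_const_mul' _ _ ENNReal.ofReal_ne_top,
      lintegral_pow_mul_sub_pow ha, ← ENNReal.ofReal_mul hC0]
    have hN' : ∑ i, t i + s + (k + 1) = t 0 + N + 1 := by
      rw [Fin.sum_univ_succ, hN]; ring
    rw [hN', Fin.prod_univ_succ, hC]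
    have : (N.factorial : ℝ) ≠ 0 := by positivity
    congr 1
    field_simp

theorem scaledSimplex_one (k : ℕ) : scaledSimplex k 1 = openSimplex k := rfl

theorem measurableSet_openSimplex (k : ℕ) : MeasurableSet (openSimplex k) :=
  measurableSet_scaledSimplex k 1

theorem mem_Ioo_of_mem_openSimplex {k : ℕ} {θ : Fin k → ℝ} (h : θ ∈ openSimplex k) (i : Fin k) :
    0 < θ i ∧ θ i < 1 :=
  ⟨h.1 i, (Finset.single_le_sum (fun j _ => (h.1 j).le) (Finset.mem_univ i)).trans_lt h.2⟩

theorem volume_openSimplex_lt_top (k : ℕ) : volume (openSimplex k) < ⊤ := by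
  refine (measure_mono (t := Set.Icc 0 1) fun θ h => ?_).trans_lt
    (isCompact_Icc (a := (0 : Fin k → ℝ))).measure_lt_top
  exact ⟨fun i => (mem_Ioo_of_mem_openSimplex h i).1.le,
    fun i => (mem_Ioo_of_mem_openSimplex h i).2.le⟩

theorem cellProb_pos {k : ℕ} {θ : Fin k → ℝ} (h : θ ∈ openSimplex k) (j : Fin (k + 1)) :
    0 < cellProb θ j := by
  induction j using Fin.lastCases with
  | last => simpa [cellProb] using h.2
  | cast i => simpa [cellProb] using h.1 i

theorem sum_cellProb {k : ℕ} (θ : Fin k → ℝ) : ∑ j, cellProb θ j = 1 := by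
  simp [cellProb, Fin.sum_univ_castSucc]

theorem cellProb_le_one {k : ℕ} {θ : Fin k → ℝ} (h : θ ∈ openSimplex k) (j : Fin (k + 1)) :
    cellProb θ j ≤ 1 :=
  (Finset.single_le_sum (fun j _ => (cellProb_pos h j).le) (Finset.mem_univ j)).trans
    (sum_cellProb θ).le

theorem continuous_cellProb {k : ℕ} (j : Fin (k + 1)) :
    Continuous fun θ : Fin k → ℝ => cellProb θ j := by
  induction j using Fin.lastCases with
  | last => simp only [cellProb, Fin.snoc_last]; fun_prop
  | cast i => simp only [cellProb, Fin.snoc_castSucc]; fun_prop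

/-- The Dirichlet integral over the open simplex. -/
theorem integral_prod_cellProb_pow {k : ℕ} (u : Fin (k + 1) → ℕ) :
    ∫ θ in openSimplex k, ∏ j, cellProb θ j ^ u j =
      (∏ j, ((u j).factorial : ℝ)) / (∑ j, u j + k).factorial := by
  have hc : Continuous fun θ : Fin k → ℝ => ∏ j, cellProb θ j ^ u j :=
    continuous_finsetProd _ fun j _ => (continuous_cellProb j).pow _
  rw [integral_eq_lintegral_of_nonneg_ae _ hc.aestronglyMeasurable]
  · have h := lintegral_scaledSimplex (fun i => u (Fin.castSucc i)) (u (Fin.last k)) one_pos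
    simp only [one_pow, one_mul, scaledSimplex_one] at h
    simp only [Fin.prod_univ_castSucc, Fin.sum_univ_castSucc]
    simp only [cellProb, Fin.snoc_castSucc, Fin.snoc_last]
    rw [h, ENNReal.toReal_ofReal (by positivity)]
  · filter_upwards [ae_restrict_mem (measurableSet_openSimplex k)] with θ h
    exact Finset.prod_nonneg fun j _ => pow_nonneg (cellProb_pos h j).le _

end MultinomialPrior

/-! ### Multinomial probabilities and the uniform-prior posterior -/

namespace MultinomialPrior

theorem mem_countSet {k n : ℕ} {t : Fin k → ℕ} : t ∈ countSet k n ↔ ∑ i, t i ≤ n := by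
  simp only [countSet, Finset.mem_filter, Fintype.mem_piFinset, Finset.mem_range,
    and_iff_right_iff_imp, Nat.lt_succ_iff]
  exact fun h i => (Finset.single_le_sum (fun j _ => Nat.zero_le _) (Finset.mem_univ i)).trans h

theorem sum_cellCount {k n : ℕ} {t : Fin k → ℕ} (h : t ∈ countSet k n) :
    ∑ j, cellCount n t j = n := by
  rw [mem_countSet] at h
  simp [cellCount, Fin.sum_univ_castSucc, h]

/-- The multinomial coefficient of the vector `t` of cell counts. -/
noncomputable def multCoeff {k : ℕ} (n : ℕ) (t : Fin k → ℕ) : ℝ :=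
  n.factorial / ∏ j, ((cellCount n t j).factorial : ℝ)

theorem multCoeff_pos {k : ℕ} (n : ℕ) (t : Fin k → ℕ) : 0 < multCoeff n t := by
  unfold multCoeff
  have := n.factorial_pos
  have : 0 < ∏ j, ((cellCount n t j).factorial : ℝ) :=
    Finset.prod_pos fun j _ => by exact_mod_cast Nat.factorial_pos _
  positivity

/-- The likelihood kernel `∏ θ_j ^ t_j`. -/
noncomputable def kernelProd {k : ℕ} (n : ℕ) (t : Fin k → ℕ) (θ : Fin k → ℝ) : ℝ :=
  ∏ j, cellProb θ j ^ cellCount n t j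

theorem continuous_kernelProd {k : ℕ} (n : ℕ) (t : Fin k → ℕ) : Continuous (kernelProd n t) :=
  continuous_finsetProd _ fun j _ => (continuous_cellProb j).pow _

theorem kernelProd_nonneg {k : ℕ} (n : ℕ) (t : Fin k → ℕ) {θ : Fin k → ℝ}
    (h : θ ∈ openSimplex k) : 0 ≤ kernelProd n t θ :=
  Finset.prod_nonneg fun j _ => pow_nonneg (cellProb_pos h j).le _

theorem kernelProd_le_one {k : ℕ} (n : ℕ) (t : Fin k → ℕ) {θ : Fin k → ℝ}
    (h : θ ∈ openSimplex k) : kernelProd n t θ ≤ 1 :=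
  Finset.prod_le_one (fun j _ => pow_nonneg (cellProb_pos h j).le _)
    fun j _ => pow_le_one₀ (cellProb_pos h j).le (cellProb_le_one h j)

theorem predictive_eq {k : ℕ} (π : (Fin k → ℝ) → ℝ) (n : ℕ) (t : Fin k → ℕ) :
    predictive π n t = multCoeff n t * ∫ θ in openSimplex k, kernelProd n t θ * π θ := rfl

/-! ### The multinomial distribution -/

/-- The multinomial theorem. -/
theorem sum_multCoeff_mul_prod_pow {k : ℕ} (n : ℕ) (y : Fin (k + 1) → ℝ) :
    ∑ t ∈ countSet k n, multCoeff n t * ∏ j, y j ^ cellCount n t j = (∑ j, y j) ^ n := by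
  rw [Finset.sum_pow_eq_sum_piAntidiag]
  refine Finset.sum_bij' (fun t _ => cellCount n t) (fun u _ i => u (Fin.castSucc i))
    ?_ ?_ ?_ ?_ ?_
  · intro t ht
    simp [sum_cellCount ht]
  · intro u hu
    simp only [Finset.mem_piAntidiag, Fin.sum_univ_castSucc] at hu
    rw [mem_countSet]
    omega
  · intro t _
    ext i
    simp [cellCount]
  · intro u hu
    simp only [Finset.mem_piAntidiag, Fin.sum_univ_castSucc] at hu
    ext j
    induction j using Fin.lastCases with
    | last => simp only [cellCount, Fin.snoc_last]; omega
    | cast i => simp [cellCount]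
  · intro t ht
    congr 1
    have h := Nat.multinomial_spec Finset.univ (cellCount n t)
    rw [sum_cellCount ht] at h
    have h0 : ∏ j, ((cellCount n t j).factorial : ℝ) ≠ 0 :=
      Finset.prod_ne_zero_iff.2 fun j _ => by exact_mod_cast Nat.factorial_ne_zero _
    rw [multCoeff, div_eq_iff h0, ← h]
    push_cast
    ring

theorem sum_multCoeff_mul_kernelProd {k : ℕ} (n : ℕ) (θ : Fin k → ℝ) :
    ∑ t ∈ countSet k n, multCoeff n t * kernelProd n t θ = 1 := by
  simp only [kernelProd]
  rw [sum_multCoeff_mul_prod_pow, sum_cellProb, one_pow]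

/-- A sub-Gaussian bound on the moment generating function of a centred cell count, the input to the
Chernoff bound below. -/
theorem sum_mul_exp_le {k : ℕ} (n : ℕ) {θ : Fin k → ℝ} (hθ : θ ∈ openSimplex k) (i : Fin k)
    {s : ℝ} (hs : |s| ≤ 1) :
    ∑ t ∈ countSet k n, multCoeff n t * kernelProd n t θ * Real.exp (s * (t i - n * θ i)) ≤
      Real.exp (n * s ^ 2) := by
  classical
  have h1 : ∑ t ∈ countSet k n, multCoeff n t * kernelProd n t θ * Real.exp (s * t i) =
      (1 + θ i * (Real.exp s - 1)) ^ n := by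
    -- Tilting cell `i` by `exp s` in the multinomial theorem yields the generating function.
    have h := sum_multCoeff_mul_prod_pow n
      (fun j => cellProb θ j * (if j = Fin.castSucc i then Real.exp s else 1))
    have hy : ∑ j, cellProb θ j * (if j = Fin.castSucc i then Real.exp s else 1) =
        1 + θ i * (Real.exp s - 1) := by
      have : ∀ j, cellProb θ j * (if j = Fin.castSucc i then Real.exp s else 1) =
          cellProb θ j + if j = Fin.castSucc i then cellProb θ j * (Real.exp s - 1) else 0 := by
        intro j
        split_ifs <;> ring
      simp_rw [this, Finset.sum_add_distrib, sum_cellProb, Finset.sum_ite_eq', Finset.mem_univ,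
        if_true]
      simp [cellProb]
    rw [hy] at h
    rw [← h]
    refine Finset.sum_congr rfl fun t _ => ?_
    rw [mul_assoc]
    congr 1
    simp_rw [mul_pow, Finset.prod_mul_distrib, kernelProd, ite_pow, one_pow, Finset.prod_ite_eq',
      Finset.mem_univ, if_true]
    simp [cellCount, ← Real.exp_nat_mul, mul_comm]
  -- From `exp s - 1 ≤ s + s ^ 2` for `|s| ≤ 1`, `θ i < 1`, and `1 + u ≤ exp u`.
  have hb : 1 + θ i * (Real.exp s - 1) ≤ Real.exp (θ i * s + s ^ 2) := by
    have h2 := (abs_le.1 (Real.abs_exp_sub_one_sub_id_le hs)).2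
    have h3 := mem_Ioo_of_mem_openSimplex hθ i
    have h4 := Real.add_one_le_exp (θ i * s + s ^ 2)
    nlinarith [sq_nonneg s]
  have h0 : 0 ≤ 1 + θ i * (Real.exp s - 1) := by
    have h3 := mem_Ioo_of_mem_openSimplex hθ i
    nlinarith [mul_pos h3.1 (Real.exp_pos s)]
  calc _ = (∑ t ∈ countSet k n, multCoeff n t * kernelProd n t θ * Real.exp (s * t i)) *
        Real.exp (-(n * (θ i * s))) := by
        rw [Finset.sum_mul]
        refine Finset.sum_congr rfl fun t _ => ?_
        rw [mul_assoc _ _ (Real.exp (-(n * (θ i * s)))), ← Real.exp_add]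
        congr 2
        ring
    _ ≤ Real.exp (θ i * s + s ^ 2) ^ n * Real.exp (-(n * (θ i * s))) := by
        rw [h1]
        gcongr
    _ = _ := by
        rw [← Real.exp_nat_mul, ← Real.exp_add]
        congr 1
        ring

/-- The weak law of large numbers for the multinomial distribution. -/
theorem tendsto_sum_filter_not_near {k : ℕ} {θ : Fin k → ℝ} (hθ : θ ∈ openSimplex k) {δ : ℝ}
    (hδ : 0 < δ) :
    Tendsto (fun n : ℕ => ∑ t ∈ (countSet k n).filter (fun t => ∃ i, n * δ ≤ |t i - n * θ i|),
      multCoeff n t * kernelProd n t θ) atTop (𝓝 0) := by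
  -- Shrinking `δ` enlarges the far set; `δ ≤ 1` makes the tilts `±δ / 2` admissible.
  wlog hδ1 : δ ≤ 1 generalizing δ
  · refine squeeze_zero (fun n => ?_) (fun n => ?_) (this one_pos le_rfl)
    · exact Finset.sum_nonneg fun t _ =>
        mul_nonneg (multCoeff_pos n t).le (kernelProd_nonneg n t hθ)
    · refine Finset.sum_le_sum_of_subset_of_nonneg
        (Finset.monotone_filter_right _ fun t _ => ?_)
        fun t _ _ => mul_nonneg (multCoeff_pos n t).le (kernelProd_nonneg n t hθ)
      rintro ⟨i, hi⟩
      exact ⟨i, le_trans (mul_le_mul_of_nonneg_left (not_le.1 hδ1).le n.cast_nonneg) hi⟩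
  have hlim : Tendsto (fun n : ℕ => k * (2 * Real.exp (-(δ ^ 2 / 4)) ^ n)) atTop (𝓝 0) := by
    have := (tendsto_pow_atTop_nhds_zero_of_lt_one (Real.exp_pos (-(δ ^ 2 / 4))).le
      (Real.exp_lt_one_iff.2 (neg_lt_zero.2 (by positivity)))).const_mul 2 |>.const_mul (k : ℝ)
    simpa using this
  refine squeeze_zero (fun n => ?_) (fun n => ?_) hlim
  · exact Finset.sum_nonneg fun t _ =>
      mul_nonneg (multCoeff_pos n t).le (kernelProd_nonneg n t hθ)
  have hs1 : |δ / 2| ≤ 1 := by rw [abs_of_pos (by positivity)]; linarith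
  have hs2 : |-(δ / 2)| ≤ 1 := by rwa [abs_neg]
  -- Chernoff weights: on the far set some `e i t` is at least 1, since `δ / 2 * (n * δ)` cancels
  -- the prefactor. Their mean is at most `2 * exp (-n * δ ^ 2 / 4)`.
  set e : Fin k → (Fin k → ℕ) → ℝ := fun i t =>
    Real.exp (-(n * (δ ^ 2 / 2))) * (Real.exp (δ / 2 * (t i - n * θ i)) +
      Real.exp (-(δ / 2) * (t i - n * θ i))) with he
  have he0 : ∀ i t, 0 ≤ e i t := fun i t => by positivity
  calc _ ≤ ∑ t ∈ (countSet k n).filter (fun t => ∃ i, n * δ ≤ |t i - n * θ i|),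
        multCoeff n t * kernelProd n t θ * ∑ i, e i t := by
        refine Finset.sum_le_sum fun t ht => le_mul_of_one_le_right
          (mul_nonneg (multCoeff_pos n t).le (kernelProd_nonneg n t hθ)) ?_
        obtain ⟨i, hi⟩ := (Finset.mem_filter.1 ht).2
        refine le_trans ?_ (Finset.single_le_sum (fun j _ => he0 j t) (Finset.mem_univ i))
        rw [he]
        simp only [mul_add, ← Real.exp_add]
        rcases le_abs.1 hi with h | h
        · refine le_add_of_le_of_nonneg (Real.one_le_exp ?_) (Real.exp_pos _).le
          nlinarith
        · refine le_add_of_nonneg_of_le (Real.exp_pos _).le (Real.one_le_exp ?_)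
          nlinarith
    _ ≤ ∑ t ∈ countSet k n, multCoeff n t * kernelProd n t θ * ∑ i, e i t :=
        Finset.sum_le_sum_of_subset_of_nonneg (Finset.filter_subset _ _) fun t _ _ =>
          mul_nonneg (mul_nonneg (multCoeff_pos n t).le (kernelProd_nonneg n t hθ))
            (Finset.sum_nonneg fun i _ => he0 i t)
    _ = ∑ i, ∑ t ∈ countSet k n, multCoeff n t * kernelProd n t θ * e i t := by
        simp_rw [Finset.mul_sum]
        exact Finset.sum_comm
    _ ≤ ∑ i : Fin k, 2 * Real.exp (-(δ ^ 2 / 4)) ^ n := by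
        refine Finset.sum_le_sum fun i _ => ?_
        have h1 := sum_mul_exp_le n hθ i hs1
        have h2 := sum_mul_exp_le n hθ i hs2
        calc _ = Real.exp (-(n * (δ ^ 2 / 2))) *
              (∑ t ∈ countSet k n, multCoeff n t * kernelProd n t θ *
                  Real.exp (δ / 2 * (t i - n * θ i)) +
                ∑ t ∈ countSet k n, multCoeff n t * kernelProd n t θ *
                  Real.exp (-(δ / 2) * (t i - n * θ i))) := by
              rw [← Finset.sum_add_distrib, Finset.mul_sum]
              exact Finset.sum_congr rfl fun t _ => by rw [he]; ring
          _ ≤ Real.exp (-(n * (δ ^ 2 / 2))) *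
              (Real.exp (n * (δ / 2) ^ 2) + Real.exp (n * (-(δ / 2)) ^ 2)) := by gcongr
          _ = _ := by
              rw [neg_sq, ← two_mul, mul_left_comm, ← Real.exp_add, ← Real.exp_nat_mul]
              congr 2
              ring
    _ = _ := by simp

/-! ### Posterior moments under the uniform prior -/

/-- The posterior mean of `f` under the uniform prior, given the counts `t`. -/
noncomputable def uniformPosteriorMean {k : ℕ} (n : ℕ) (t : Fin k → ℕ) (f : (Fin k → ℝ) → ℝ) : ℝ :=
  ((n + k).factorial / ∏ j, ((cellCount n t j).factorial : ℝ)) *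
    ∫ θ in openSimplex k, kernelProd n t θ * f θ

theorem uniformPosteriorMean_eq_mul_predictive {k : ℕ} (π : (Fin k → ℝ) → ℝ) (n : ℕ)
    (t : Fin k → ℕ) :
    uniformPosteriorMean n t π = ((n + k).factorial / n.factorial) * predictive π n t := by
  have : (n.factorial : ℝ) ≠ 0 := by positivity
  rw [uniformPosteriorMean, predictive_eq, multCoeff]
  field_simp

/-- Multiplying the kernel by `θ i ^ m` raises one Dirichlet exponent by `m`, so the moment is a
ratio of two Dirichlet integrals. -/
theorem uniformPosteriorMean_pow {k n : ℕ} {t : Fin k → ℕ} (ht : t ∈ countSet k n) (i : Fin k)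
    (m : ℕ) :
    uniformPosteriorMean n t (fun θ => θ i ^ m) =
      (t i + 1).ascFactorial m / (n + k + 1).ascFactorial m := by
  classical
  have h := integral_prod_cellProb_pow
    (fun j => cellCount n t j + if j = Fin.castSucc i then m else 0)
  have e1 : ∀ θ : Fin k → ℝ,
      ∏ j, cellProb θ j ^ (cellCount n t j + if j = Fin.castSucc i then m else 0) =
        kernelProd n t θ * θ i ^ m := by
    intro θ
    simp_rw [pow_add, Finset.prod_mul_distrib, pow_ite, pow_zero, Finset.prod_ite_eq',
      Finset.mem_univ, if_true]
    simp [kernelProd, cellProb]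
  have e2 : ∏ j, ((cellCount n t j + if j = Fin.castSucc i then m else 0).factorial : ℝ) =
      (∏ j, ((cellCount n t j).factorial : ℝ)) * (t i + 1).ascFactorial m := by
    have : ∀ j, ((cellCount n t j + if j = Fin.castSucc i then m else 0).factorial : ℝ) =
        (cellCount n t j).factorial * if j = Fin.castSucc i then
          ((cellCount n t j + 1).ascFactorial m : ℝ) else 1 := by
      intro j
      split_ifs
      · rw [← Nat.factorial_mul_ascFactorial]; push_cast; ring
      · simp
    simp_rw [this, Finset.prod_mul_distrib, Finset.prod_ite_eq', Finset.mem_univ, if_true]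
    simp [cellCount]
  have e3 : ∑ j, (cellCount n t j + if j = Fin.castSucc i then m else 0) = n + m := by
    rw [Finset.sum_add_distrib, sum_cellCount ht]; simp
  simp_rw [e1] at h
  rw [uniformPosteriorMean, h, e2, e3, add_right_comm n m k, ← Nat.factorial_mul_ascFactorial (n + k) m]
  have h0 : ∏ j, ((cellCount n t j).factorial : ℝ) ≠ 0 :=
    Finset.prod_ne_zero_iff.2 fun j _ => by exact_mod_cast Nat.factorial_ne_zero _
  have : ((n + k).factorial : ℝ) ≠ 0 := by positivity
  push_cast
  field_simp

theorem uniformPosteriorMean_one {k n : ℕ} {t : Fin k → ℕ} (ht : t ∈ countSet k n) :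
    uniformPosteriorMean n t (fun _ => 1) = 1 := by
  have h := integral_prod_cellProb_pow (cellCount n t)
  rw [sum_cellCount ht] at h
  have h0 : ∏ j, ((cellCount n t j).factorial : ℝ) ≠ 0 :=
    Finset.prod_ne_zero_iff.2 fun j _ => by exact_mod_cast Nat.factorial_ne_zero _
  have : ((n + k).factorial : ℝ) ≠ 0 := by positivity
  simp only [uniformPosteriorMean, mul_one]
  simp only [kernelProd]
  rw [h]
  field_simp

theorem integrableOn_kernelProd_mul {k : ℕ} (n : ℕ) (t : Fin k → ℕ) {f : (Fin k → ℝ) → ℝ}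
    (hf : IntegrableOn f (openSimplex k)) :
    IntegrableOn (fun θ => kernelProd n t θ * f θ) (openSimplex k) := by
  refine Integrable.bdd_mul (c := 1) hf (continuous_kernelProd n t).aestronglyMeasurable ?_
  filter_upwards [ae_restrict_mem (measurableSet_openSimplex k)] with θ h
  rw [Real.norm_of_nonneg (kernelProd_nonneg n t h)]
  exact kernelProd_le_one n t h

theorem integrableOn_of_continuous {k : ℕ} {f : (Fin k → ℝ) → ℝ} (hf : Continuous f) :
    IntegrableOn f (openSimplex k) := by
  refine (hf.continuousOn.integrableOn_compact
    (isCompact_Icc (a := (0 : Fin k → ℝ)) (b := 1))).mono_set fun θ h => ?_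
  exact ⟨fun i => (mem_Ioo_of_mem_openSimplex h i).1.le,
    fun i => (mem_Ioo_of_mem_openSimplex h i).2.le⟩

theorem uniformPosteriorMean_add {k : ℕ} (n : ℕ) (t : Fin k → ℕ) {f g : (Fin k → ℝ) → ℝ}
    (hf : IntegrableOn f (openSimplex k)) (hg : IntegrableOn g (openSimplex k)) :
    uniformPosteriorMean n t (fun θ => f θ + g θ) =
      uniformPosteriorMean n t f + uniformPosteriorMean n t g := by
  simp only [uniformPosteriorMean, mul_add]
  rw [integral_add (integrableOn_kernelProd_mul n t hf) (integrableOn_kernelProd_mul n t hg),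
    mul_add]

theorem uniformPosteriorMean_const_mul {k : ℕ} (n : ℕ) (t : Fin k → ℕ) (c : ℝ)
    (f : (Fin k → ℝ) → ℝ) :
    uniformPosteriorMean n t (fun θ => c * f θ) = c * uniformPosteriorMean n t f := by
  simp only [uniformPosteriorMean, mul_left_comm _ c]
  rw [integral_const_mul]
  ring

theorem uniformPosteriorMean_const {k n : ℕ} {t : Fin k → ℕ} (ht : t ∈ countSet k n) (c : ℝ) :
    uniformPosteriorMean n t (fun _ => c) = c := by
  have := uniformPosteriorMean_const_mul n t c (fun _ => 1)
  simpa [uniformPosteriorMean_one ht] using this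

theorem uniformPosteriorMean_sum {k : ℕ} (n : ℕ) (t : Fin k → ℕ) {ι : Type*} (s : Finset ι)
    {f : ι → (Fin k → ℝ) → ℝ} (hf : ∀ i ∈ s, IntegrableOn (f i) (openSimplex k)) :
    uniformPosteriorMean n t (fun θ => ∑ i ∈ s, f i θ) =
      ∑ i ∈ s, uniformPosteriorMean n t (f i) := by
  simp only [uniformPosteriorMean, Finset.mul_sum]
  rw [integral_finsetSum _ fun i hi => integrableOn_kernelProd_mul n t (hf i hi), Finset.mul_sum]

theorem uniformPosteriorMean_mono {k : ℕ} (n : ℕ) (t : Fin k → ℕ) {f g : (Fin k → ℝ) → ℝ}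
    (hf : IntegrableOn f (openSimplex k)) (hg : IntegrableOn g (openSimplex k))
    (h : ∀ θ ∈ openSimplex k, f θ ≤ g θ) :
    uniformPosteriorMean n t f ≤ uniformPosteriorMean n t g := by
  refine mul_le_mul_of_nonneg_left ?_ (by positivity)
  exact setIntegral_mono_on (integrableOn_kernelProd_mul n t hf)
    (integrableOn_kernelProd_mul n t hg) (measurableSet_openSimplex k) fun θ hθ =>
      mul_le_mul_of_nonneg_left (h θ hθ) (kernelProd_nonneg n t hθ)

theorem uniformPosteriorMean_sub_sq {k n : ℕ} {t : Fin k → ℕ} (ht : t ∈ countSet k n)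
    (i : Fin k) (c : ℝ) :
    uniformPosteriorMean n t (fun θ => (θ i - c) ^ 2) =
      (t i + 1) * (t i + 2) / ((n + k + 1) * (n + k + 2)) -
        2 * c * ((t i + 1) / (n + k + 1)) + c ^ 2 := by
  have h1 := uniformPosteriorMean_pow ht i 1
  have h2 := uniformPosteriorMean_pow ht i 2
  have e : (fun θ : Fin k → ℝ => (θ i - c) ^ 2) =
      fun θ => (θ i ^ 2 + -(2 * c) * θ i ^ 1) + c ^ 2 := by
    ext θ; ring
  rw [e, uniformPosteriorMean_add n t (integrableOn_of_continuous (by fun_prop))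
    (integrableOn_of_continuous (by fun_prop)),
    uniformPosteriorMean_add n t (integrableOn_of_continuous (by fun_prop))
    (integrableOn_of_continuous (by fun_prop)), uniformPosteriorMean_const_mul,
    uniformPosteriorMean_const ht, h1, h2]
  simp only [Nat.ascFactorial]
  push_cast
  ring

/-- Both factors of the second moment, and the first moment, tend to `θ₀ i`, so the explicit formula
collapses to a perfect square that vanishes. -/
theorem tendsto_uniformPosteriorMean_sub_sq {k : ℕ} {ι : Type*} {l : Filter ι} {n : ι → ℕ}
    {t : ι → Fin k → ℕ} {θ₀ : Fin k → ℝ} (hn : Tendsto n l atTop)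
    (ht : ∀ᶠ a in l, t a ∈ countSet k (n a)) (i : Fin k)
    (hlim : Tendsto (fun a => (t a i : ℝ) / n a) l (𝓝 (θ₀ i))) :
    Tendsto (fun a => uniformPosteriorMean (n a) (t a) fun θ => (θ i - θ₀ i) ^ 2) l (𝓝 0) := by
  have hinv : Tendsto (fun a => ((n a : ℕ) : ℝ)⁻¹) l (𝓝 0) :=
    tendsto_inv_atTop_nhds_zero_nat.comp hn
  have hT : ∀ c d : ℝ, Tendsto (fun a => ((t a i : ℝ) / n a + c * (n a : ℝ)⁻¹) /
      (1 + d * (n a : ℝ)⁻¹)) l (𝓝 (θ₀ i)) := by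
    intro c d
    have := (hlim.add (hinv.const_mul c)).div ((hinv.const_mul d).const_add 1) (by simp)
    simpa [Pi.div_def] using this
  have := (((hT 1 (k + 1)).mul (hT 2 (k + 2))).sub ((hT 1 (k + 1)).const_mul (2 * θ₀ i))).add_const
    (θ₀ i ^ 2)
  have hz : θ₀ i * θ₀ i - 2 * θ₀ i * θ₀ i + θ₀ i ^ 2 = 0 := by ring
  rw [hz] at this
  refine this.congr' ?_
  filter_upwards [ht, hn.eventually_gt_atTop 0] with a h h0
  have h0' : (n a : ℝ) ≠ 0 := by exact_mod_cast h0.ne'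
  have e : ∀ c d : ℝ, ((t a i : ℝ) / n a + c * (n a : ℝ)⁻¹) / (1 + d * (n a : ℝ)⁻¹) =
      (t a i + c) / (n a + d) := by
    intro c d
    rw [← mul_div_mul_left _ _ h0']
    congr 1 <;> field_simp
  rw [uniformPosteriorMean_sub_sq h, e, e, ← add_assoc, ← add_assoc, div_mul_div_comm]

/-- Consistency of the uniform-prior posterior mean of a bounded function at a continuity point. -/
theorem tendsto_uniformPosteriorMean {k : ℕ} {π : (Fin k → ℝ) → ℝ}
    (hπ : IntegrableOn π (openSimplex k)) {B : ℝ} (hB : ∀ θ ∈ openSimplex k, |π θ| ≤ B)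
    {θ₀ : Fin k → ℝ} (hθ₀ : θ₀ ∈ contPts π) {ι : Type*} {l : Filter ι} {n : ι → ℕ}
    {t : ι → Fin k → ℕ} (hn : Tendsto n l atTop) (ht : ∀ᶠ a in l, t a ∈ countSet k (n a))
    (hlim : ∀ i, Tendsto (fun a => (t a i : ℝ) / n a) l (𝓝 (θ₀ i))) :
    Tendsto (fun a => uniformPosteriorMean (n a) (t a) π) l (𝓝 (π θ₀)) := by
  rw [Metric.tendsto_nhds]
  intro ε hε
  obtain ⟨δ, hδ, hδε⟩ := Metric.continuousWithinAt_iff.1 hθ₀.2 (ε / 2) (by positivity)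
  have hB0 : 0 ≤ B := (abs_nonneg _).trans (hB θ₀ hθ₀.1)
  -- Chosen so that `K * δ ^ 2 = 2 * B`: beyond distance `δ` the quadratic term alone dominates the
  -- oscillation of `π`, as in Chebyshev's inequality.
  set K := 2 * B / δ ^ 2 with hK
  have hK0 : 0 ≤ K := by positivity
  have hpt : ∀ θ ∈ openSimplex k, |π θ - π θ₀| ≤ ε / 2 + K * ∑ i, (θ i - θ₀ i) ^ 2 := by
    intro θ hθ
    have hs : 0 ≤ ∑ i, (θ i - θ₀ i) ^ 2 := Finset.sum_nonneg fun i _ => sq_nonneg _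
    by_cases hd : dist θ θ₀ < δ
    · have := hδε hθ hd
      rw [Real.dist_eq] at this
      have := mul_nonneg hK0 hs
      linarith
    · rw [dist_pi_lt_iff hδ] at hd
      push Not at hd
      obtain ⟨i, hi⟩ := hd
      rw [Real.dist_eq] at hi
      have h1 : δ ^ 2 ≤ ∑ i, (θ i - θ₀ i) ^ 2 := by
        refine le_trans ?_ (Finset.single_le_sum (f := fun i => (θ i - θ₀ i) ^ 2)
          (fun j _ => sq_nonneg _) (Finset.mem_univ i))
        rw [← sq_abs (θ i - θ₀ i)]
        gcongr
      have h2 : 2 * B = K * δ ^ 2 := by rw [hK]; field_simp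
      have h3 := mul_le_mul_of_nonneg_left h1 hK0
      have h4 := abs_sub (π θ) (π θ₀)
      have := hB θ hθ
      have := hB θ₀ hθ₀.1
      linarith
  have hsq : Tendsto (fun a => K * ∑ i, uniformPosteriorMean (n a) (t a)
      fun θ => (θ i - θ₀ i) ^ 2) l (𝓝 0) := by
    have := (tendsto_finsetSum Finset.univ fun i _ =>
      tendsto_uniformPosteriorMean_sub_sq hn ht i (hlim i)).const_mul K
    simpa using this
  filter_upwards [ht, hsq.eventually_lt_const (half_pos hε)] with a h1 h2
  have hsqI : IntegrableOn (fun θ : Fin k → ℝ => K * ∑ i, (θ i - θ₀ i) ^ 2) (openSimplex k) :=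
    integrableOn_of_continuous (by fun_prop)
  have hconst : ∀ c : ℝ, IntegrableOn (fun _ : Fin k → ℝ => c) (openSimplex k) :=
    fun c => integrableOn_of_continuous continuous_const
  have hK' : uniformPosteriorMean (n a) (t a) (fun θ => K * ∑ i, (θ i - θ₀ i) ^ 2) < ε / 2 := by
    rwa [uniformPosteriorMean_const_mul, uniformPosteriorMean_sum _ _ _ fun i _ =>
      integrableOn_of_continuous (by fun_prop)]
  have hup := uniformPosteriorMean_mono (n a) (t a) hπ
    ((hconst (π θ₀ + ε / 2)).add hsqI) fun θ hθ => by
      have := (abs_le.1 (hpt θ hθ)).2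
      simp only [Pi.add_apply]
      linarith
  have hlo := uniformPosteriorMean_mono (n a) (t a) (hconst (π θ₀ - ε / 2)) (hπ.add hsqI)
    fun θ hθ => by
      have := (abs_le.1 (hpt θ hθ)).1
      simp only [Pi.add_apply]
      linarith
  have e1 := uniformPosteriorMean_add (n a) (t a) (hconst (π θ₀ + ε / 2)) hsqI
  have e2 := uniformPosteriorMean_add (n a) (t a) hπ hsqI
  rw [uniformPosteriorMean_const h1] at hlo e1
  simp only [Pi.add_def] at hup hlo
  rw [Real.dist_eq, abs_lt]
  constructor <;> linarith

end MultinomialPrior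

/-! ### Limit of the p-value -/

namespace MultinomialPrior

/-- Locally uniform version of `tendsto_uniformPosteriorMean`. -/
theorem exists_abs_uniformPosteriorMean_sub_lt {k : ℕ} {π : (Fin k → ℝ) → ℝ}
    (hπ : IntegrableOn π (openSimplex k)) {B : ℝ} (hB : ∀ θ ∈ openSimplex k, |π θ| ≤ B)
    {θ₀ : Fin k → ℝ} (hθ₀ : θ₀ ∈ contPts π) {η : ℝ} (hη : 0 < η) :
    ∃ δ > 0, ∃ N : ℕ, ∀ n ≥ N, ∀ t ∈ countSet k n, (∀ i, |(t i : ℝ) - n * θ₀ i| < n * δ) →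
      |uniformPosteriorMean n t π - π θ₀| < η := by
  by_contra! H
  -- Failure at every radius `1 / (m + 1)` produces sample sizes and counts whose frequencies
  -- converge to `θ₀`, contradicting convergence along sequences.
  have H' : ∀ m : ℕ, ∃ n ≥ m, ∃ t ∈ countSet k n,
      (∀ i, |(t i : ℝ) - n * θ₀ i| < n * (1 / ((m : ℝ) + 1))) ∧
        η ≤ |uniformPosteriorMean n t π - π θ₀| := fun m => H _ (by positivity) m
  choose n hn t ht hnear hbad using H'
  have hn' : Tendsto n atTop atTop := tendsto_atTop_mono hn tendsto_id
  have hlim : ∀ i, Tendsto (fun m => (t m i : ℝ) / n m) atTop (𝓝 (θ₀ i)) := by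
    intro i
    rw [tendsto_iff_dist_tendsto_zero]
    refine squeeze_zero' (Eventually.of_forall fun _ => dist_nonneg) ?_
      (tendsto_one_div_add_atTop_nhds_zero_nat (𝕜 := ℝ))
    filter_upwards [hn'.eventually_gt_atTop 0] with m hm
    have hm' : (0 : ℝ) < n m := by exact_mod_cast hm
    have h := hnear m i
    have e : (t m i : ℝ) / n m - θ₀ i = (t m i - n m * θ₀ i) / n m := by field_simp
    rw [Real.dist_eq, e, abs_div, abs_of_pos hm', div_le_iff₀ hm', mul_comm (1 / _)]
    exact h.le
  have := tendsto_uniformPosteriorMean hπ hB hθ₀ hn' (Eventually.of_forall ht) hlim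
  obtain ⟨m, hm⟩ := (Metric.tendsto_nhds.1 this η hη).exists
  rw [Real.dist_eq] at hm
  exact absurd hm (not_lt.2 (hbad m))

/-- The multinomial probability that the posterior mean is at most `c n`, when the levels `c n`
converge. -/
theorem tendsto_sum_filter_uniformPosteriorMean_le {k : ℕ} {π : (Fin k → ℝ) → ℝ}
    (hπ : IntegrableOn π (openSimplex k)) {B : ℝ} (hB : ∀ θ ∈ openSimplex k, |π θ| ≤ B)
    {θ : Fin k → ℝ} (hθ : θ ∈ contPts π) {c : ℕ → ℝ} {l : ℝ} (hc : Tendsto c atTop (𝓝 l))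
    (hne : π θ ≠ l) :
    Tendsto (fun n : ℕ => ∑ t ∈ (countSet k n).filter (fun t => uniformPosteriorMean n t π ≤ c n),
      multCoeff n t * kernelProd n t θ) atTop (𝓝 (if π θ ≤ l then 1 else 0)) := by
  have hnn : ∀ n t, 0 ≤ multCoeff n t * kernelProd n t θ := fun n t =>
    mul_nonneg (multCoeff_pos n t).le (kernelProd_nonneg n t hθ.1)
  -- Within half the gap of their limits, the posterior mean and `c n` are ordered as `π θ` and `l`;
  -- an exception forces `t` into the far set.
  have hη : 0 < |π θ - l| / 2 := half_pos (abs_pos.2 (sub_ne_zero.2 hne))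
  obtain ⟨δ, hδ, N, hN⟩ := exists_abs_uniformPosteriorMean_sub_lt hπ hB hθ hη
  have hfar := tendsto_sum_filter_not_near hθ.1 hδ
  have hcη := Metric.tendsto_nhds.1 hc _ hη
  rcases lt_or_gt_of_ne hne with h | h
  · rw [if_pos h.le]
    have hcompl : Tendsto (fun n : ℕ => ∑ t ∈ (countSet k n).filter
        (fun t => ¬ uniformPosteriorMean n t π ≤ c n), multCoeff n t * kernelProd n t θ)
        atTop (𝓝 0) := by
      refine squeeze_zero' (Eventually.of_forall fun n => Finset.sum_nonneg fun t _ => hnn n t)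
        ?_ hfar
      filter_upwards [hcη, eventually_ge_atTop N] with n h1 h2
      refine Finset.sum_le_sum_of_subset_of_nonneg (fun t ht => ?_) fun t _ _ => hnn n t
      rw [Finset.mem_filter] at ht ⊢
      refine ⟨ht.1, ?_⟩
      by_contra! h3
      have h4 := (abs_lt.1 (hN n h2 t ht.1 h3)).2
      rw [Real.dist_eq] at h1
      have h5 := (abs_lt.1 h1).1
      rw [abs_of_neg (sub_neg.2 h)] at h4 h5
      have := ht.2
      linarith
    have := hcompl.const_sub 1
    rw [sub_zero] at this
    refine this.congr fun n => ?_
    rw [← sum_multCoeff_mul_kernelProd n θ, ← Finset.sum_filter_add_sum_filter_not (countSet k n)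
      (fun t => uniformPosteriorMean n t π ≤ c n), add_sub_cancel_right]
  · rw [if_neg (not_le.2 h)]
    refine squeeze_zero' (Eventually.of_forall fun n => Finset.sum_nonneg fun t _ => hnn n t)
      ?_ hfar
    filter_upwards [hcη, eventually_ge_atTop N] with n h1 h2
    refine Finset.sum_le_sum_of_subset_of_nonneg (fun t ht => ?_) fun t _ _ => hnn n t
    rw [Finset.mem_filter] at ht ⊢
    refine ⟨ht.1, ?_⟩
    by_contra! h3
    have h4 := (abs_lt.1 (hN n h2 t ht.1 h3)).1
    rw [Real.dist_eq] at h1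
    have h5 := (abs_lt.1 h1).2
    rw [abs_of_pos (sub_pos.2 h)] at h4 h5
    have := ht.2
    linarith

theorem predictive_nonneg {k : ℕ} {π : (Fin k → ℝ) → ℝ} (h0 : ∀ θ ∈ openSimplex k, 0 ≤ π θ)
    (n : ℕ) (t : Fin k → ℕ) : 0 ≤ predictive π n t :=
  mul_nonneg (multCoeff_pos n t).le <| setIntegral_nonneg (measurableSet_openSimplex k) fun θ hθ =>
    mul_nonneg (kernelProd_nonneg n t hθ) (h0 θ hθ)

/-- The p-value is a mixture, over the prior, of multinomial probabilities. -/
theorem pValue_eq_integral {k : ℕ} {π : (Fin k → ℝ) → ℝ} (hπ : IntegrableOn π (openSimplex k))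
    (h0 : ∀ θ ∈ openSimplex k, 0 ≤ π θ) (n : ℕ) (T : Fin k → ℕ) :
    pValue π n T = ∫ θ in openSimplex k, (∑ t ∈ (countSet k n).filter
      (fun t => uniformPosteriorMean n t π ≤ uniformPosteriorMean n T π),
        multCoeff n t * kernelProd n t θ) * π θ := by
  have hiff : ∀ t : Fin k → ℕ, uniformPosteriorMean n t π ≤ uniformPosteriorMean n T π ↔
      predictive π n t ≤ predictive π n T := by
    intro t
    simp only [uniformPosteriorMean_eq_mul_predictive]
    exact mul_le_mul_iff_right₀ (by positivity)
  have h1 : pValue π n T = ∑ t ∈ (countSet k n).filter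
      (fun t => predictive π n t ≤ predictive π n T), predictive π n t := by
    rw [pValue, predictiveMeasure, measureReal_def, Measure.finsetSum_apply, ENNReal.toReal_sum,
      Finset.sum_filter]
    · refine Finset.sum_congr rfl fun t _ => ?_
      by_cases h : predictive π n t ≤ predictive π n T
      · simp [h, ENNReal.toReal_ofReal (predictive_nonneg h0 n t)]
      · simp [h]
    · intro t _
      simp only [Measure.smul_apply, smul_eq_mul]
      exact ENNReal.mul_ne_top ENNReal.ofReal_ne_top (measure_ne_top _ _)
  simp only [hiff]
  rw [h1]
  simp only [Finset.sum_mul, mul_assoc]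
  rw [integral_finsetSum _ fun t _ => (integrableOn_kernelProd_mul n t hπ).const_mul _]
  simp only [integral_const_mul, predictive_eq]

theorem prior_real_setOf_le {k : ℕ} {π : (Fin k → ℝ) → ℝ} (hπ : IsPriorDensity π) (l : ℝ) :
    (prior π).real {θ | θ ∈ openSimplex k ∧ π θ ≤ l} =
      ∫ θ in openSimplex k, (if π θ ≤ l then 1 else 0) * π θ := by
  set μ : Measure (Fin k → ℝ) := volume.restrict (openSimplex k) with hμ
  have hn : NullMeasurableSet {θ | π θ ≤ l} μ :=
    nullMeasurableSet_le hπ.aemeasurable aemeasurable_const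
  have hS : {θ | θ ∈ openSimplex k ∧ π θ ≤ l} =ᵐ[μ] {θ | π θ ≤ l} := by
    filter_upwards [ae_restrict_mem (measurableSet_openSimplex k)] with θ h
    exact propext (and_iff_right h)
  have hind : (fun θ => (if π θ ≤ l then 1 else 0) * π θ) = {θ | π θ ≤ l}.indicator π := by
    ext θ
    simp [Set.indicator_apply]
  rw [hind, integral_indicator₀ hn, measureReal_def, prior, ← hμ, measure_congr
    ((withDensity_absolutelyContinuous _ _).ae_eq hS), withDensity_apply',
    integral_eq_lintegral_of_nonneg_ae]
  · refine ae_restrict_of_ae ?_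
    filter_upwards [ae_restrict_mem (measurableSet_openSimplex k)] with θ h using hπ.nonneg θ h
  · exact hπ.aemeasurable.aestronglyMeasurable.restrict

/-- Convergence of the p-value along any sequence of counts whose frequencies converge. -/
theorem tendsto_pValue {k : ℕ} {π : (Fin k → ℝ) → ℝ} (hπ : IsPriorDensity π)
    (hA1 : ∃ B : ℝ, 0 < B ∧ ∀ θ ∈ openSimplex k, π θ ≤ B)
    (hA2 : volume (discontPts π) = 0)
    (hA3 : ∀ l : ℝ, 0 ≤ l → prior π {θ | θ ∈ openSimplex k ∧ π θ = l} = 0)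
    {θ₀ : Fin k → ℝ} (hθ₀ : θ₀ ∈ contPts π) {T : ℕ → Fin k → ℕ} (hT : ∀ n, T n ∈ countSet k n)
    (hlim : ∀ i, Tendsto (fun n : ℕ => (T n i : ℝ) / n) atTop (𝓝 (θ₀ i))) :
    Tendsto (fun n => pValue π n (T n)) atTop
      (𝓝 ((prior π).real {θ | θ ∈ openSimplex k ∧ π θ ≤ π θ₀})) := by
  obtain ⟨B, hB0, hB⟩ := hA1
  have hB' : ∀ θ ∈ openSimplex k, |π θ| ≤ B := fun θ h => by
    rw [abs_of_nonneg (hπ.nonneg θ h)]; exact hB θ h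
  have hmem := ae_restrict_mem (μ := volume) (measurableSet_openSimplex k)
  have hfin : IsFiniteMeasure (volume.restrict (openSimplex k)) :=
    isFiniteMeasure_restrict.2 (volume_openSimplex_lt_top k).ne
  have hI : IntegrableOn π (openSimplex k) :=
    Integrable.of_bound hπ.aemeasurable.aestronglyMeasurable B (by
      filter_upwards [hmem] with θ h using hB' θ h)
  have hc : Tendsto (fun n => uniformPosteriorMean n (T n) π) atTop (𝓝 (π θ₀)) :=
    tendsto_uniformPosteriorMean hI hB' hθ₀ tendsto_id (Eventually.of_forall hT) hlim
  have hcont : ∀ᵐ θ ∂volume.restrict (openSimplex k), θ ∈ contPts π := by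
    have : ∀ᵐ θ ∂volume.restrict (openSimplex k), θ ∉ discontPts π :=
      ae_restrict_of_ae (measure_eq_zero_iff_ae_notMem.1 hA2)
    filter_upwards [hmem, this] with θ h1 h2
    exact ⟨h1, by_contra fun h3 => h2 ⟨h1, h3⟩⟩
  -- (A3) bounds prior mass, not volume: the level set may have positive volume, but then `π`
  -- vanishes almost everywhere on it.
  have hlevel : ∀ᵐ θ ∂volume.restrict (openSimplex k), π θ = π θ₀ → π θ = 0 := by
    have := measure_eq_zero_iff_ae_notMem.1 (hA3 (π θ₀) (hπ.nonneg θ₀ hθ₀.1))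
    rw [prior, ae_withDensity_iff' hπ.aemeasurable.ennreal_ofReal] at this
    filter_upwards [hmem, this] with θ h1 h2 h3
    by_contra h4
    exact h2 (ENNReal.ofReal_pos.2 ((hπ.nonneg θ h1).lt_of_ne' h4)).ne' ⟨h1, h3⟩
  simp_rw [pValue_eq_integral hI hπ.nonneg, prior_real_setOf_le hπ]
  refine tendsto_integral_of_dominated_convergence (fun θ => |π θ|) (fun n => ?_) hI.abs
    (fun n => ?_) ?_
  · refine AEStronglyMeasurable.mul (Continuous.aestronglyMeasurable ?_)
      hπ.aemeasurable.aestronglyMeasurable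
    exact continuous_finsetSum _ fun t _ => (continuous_kernelProd n t).const_mul _
  · filter_upwards [hmem] with θ h
    have hnn : ∀ t, 0 ≤ multCoeff n t * kernelProd n t θ := fun t =>
      mul_nonneg (multCoeff_pos n t).le (kernelProd_nonneg n t h)
    rw [norm_mul, Real.norm_eq_abs (π θ)]
    refine mul_le_of_le_one_left (abs_nonneg _) ?_
    rw [Real.norm_of_nonneg (Finset.sum_nonneg fun t _ => hnn t)]
    exact (Finset.sum_le_sum_of_subset_of_nonneg (Finset.filter_subset _ _) fun t _ _ => hnn t).trans
      (sum_multCoeff_mul_kernelProd n θ).le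
  · filter_upwards [hcont, hlevel] with θ h1 h2
    by_cases h3 : π θ = π θ₀
    -- On the level set the inner probability need not converge, but the factor `π θ` is zero.
    · simp [h2 h3]
    · exact (tendsto_sum_filter_uniformPosteriorMean_le hI hB' h1 hc h3).mul_const _

/-! ### The observed counts -/

theorem counts_mem_countSet {k : ℕ} (n : ℕ) (x : ℕ → Fin (k + 1)) :
    counts n x ∈ countSet k n := by
  rw [mem_countSet]
  have h := Finset.card_eq_sum_card_fiberwise (f := x) (s := Finset.range n)
    (t := Finset.univ) fun _ _ => Finset.mem_coe.2 (Finset.mem_univ _)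
  rw [Finset.card_range, Fin.sum_univ_castSucc] at h
  simp only [counts]
  omega

/-- The strong law of large numbers for the cell frequencies. -/
theorem ae_tendsto_counts_div {k : ℕ} {θ : Fin k → ℝ} (hθ : θ ∈ openSimplex k) {Ω : Type*}
    [MeasurableSpace Ω] {P : Measure Ω} [IsProbabilityMeasure P] {X : ℕ → Ω → Fin (k + 1)}
    (hX : IsIIDSample P X θ) (i : Fin k) :
    ∀ᵐ ω ∂P, Tendsto (fun n : ℕ => (counts n (fun j => X j ω) i : ℝ) / n) atTop (𝓝 (θ i)) := by
  -- The count of cell `i` is a sum of i.i.d. indicators with mean `θ i`.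
  set g : Fin (k + 1) → ℝ := fun j => if j = Fin.castSucc i then 1 else 0 with hg
  have hgm : Measurable g := measurable_of_finite g
  have hident : ∀ m, IdentDistrib (X m) (X 0) P P := fun m =>
    ⟨(hX.measurable m).aemeasurable, (hX.measurable 0).aemeasurable, by
      refine Measure.ext_of_singleton fun j => ?_
      rw [Measure.map_apply (hX.measurable m) (measurableSet_singleton j),
        Measure.map_apply (hX.measurable 0) (measurableSet_singleton j), hX.law, hX.law]⟩
  have hcomp : (fun ω => g (X 0 ω)) = (X 0 ⁻¹' {Fin.castSucc i}).indicator fun _ => (1 : ℝ) := by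
    ext ω
    by_cases h : X 0 ω = Fin.castSucc i <;> simp [hg, h]
  have hmeas : MeasurableSet (X 0 ⁻¹' {Fin.castSucc i}) :=
    hX.measurable 0 (measurableSet_singleton _)
  have hint : Integrable (fun ω => g (X 0 ω)) P := by
    rw [hcomp]
    exact (integrable_const _).indicator hmeas
  have hE : ∫ ω, g (X 0 ω) ∂P = θ i := by
    rw [hcomp, integral_indicator_const _ hmeas, measureReal_def, hX.law,
      ENNReal.toReal_ofReal (cellProb_pos hθ _).le]
    simp [cellProb]
  have h := strong_law_ae_real (fun m ω => g (X m ω)) hint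
    (fun a b hab => (hX.indep.indepFun hab).comp hgm hgm) fun m => (hident m).comp hgm
  rw [hE] at h
  filter_upwards [h] with ω hω
  refine hω.congr fun n => ?_
  simp [hg, counts]

end MultinomialPrior

theorem theorem1 {k : ℕ} (π : (Fin k → ℝ) → ℝ)
    (hπ : MultinomialPrior.IsPriorDensity π)
    (hA1 : ∃ B : ℝ, 0 < B ∧ ∀ θ ∈ MultinomialPrior.openSimplex k, π θ ≤ B)
    (hA2 : volume (MultinomialPrior.discontPts π) = 0)
    (hA3 : ∀ l : ℝ, 0 ≤ l →
      MultinomialPrior.prior π {θ | θ ∈ MultinomialPrior.openSimplex k ∧ π θ = l} = 0)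
    (θtrue : Fin k → ℝ) (hθ : θtrue ∈ MultinomialPrior.contPts π)
    {Ω : Type*} [MeasurableSpace Ω] (P : Measure Ω) [IsProbabilityMeasure P]
    (X : ℕ → Ω → Fin (k + 1)) (hX : MultinomialPrior.IsIIDSample P X θtrue) :
    ∀ᵐ ω ∂P,
      Tendsto (fun n : ℕ =>
          MultinomialPrior.pValue π n (MultinomialPrior.counts n fun i => X i ω))
        atTop
        (𝓝 ((MultinomialPrior.prior π).real
          {θ | θ ∈ MultinomialPrior.openSimplex k ∧ π θ ≤ π θtrue})) := by
  have h : ∀ᵐ ω ∂P, ∀ i, Tendsto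
      (fun n : ℕ => (MultinomialPrior.counts n (fun j => X j ω) i : ℝ) / n) atTop
      (𝓝 (θtrue i)) :=
    ae_all_iff.2 fun i => MultinomialPrior.ae_tendsto_counts_div hθ.1 hX i
  filter_upwards [h] with ω hω
  exact MultinomialPrior.tendsto_pValue hπ hA1 hA2 hA3 hθ
    (fun n => MultinomialPrior.counts_mem_countSet n _) hω
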